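/- Let $k$ be a field, $G$ an abelian group, and $R=k[x_1,\ldots,x_n]$ a polynomial ring, $G$-graded so that the variables are homogeneous (of arbitrary degrees) and the constants have degree $0$. Let $B\neq 0$ be an ideal of $R$ generated by monomials. (For instance, $R$ is the Cox ring of a toric variety $X$ over $k$ and $B$ is its irrelevant ideal.) Let $f_1,\ldots,f_r\in R$ be homogeneous of the same degree $d\in G$ and let $I=(f_1,\ldots,f_r)$. A graded prime of $R$ is a proper homogeneous ideal $P$ such that, for all homogeneous $a,b\in R$, $ab\in P$ implies $a\in P$ or $b\in P$ (if $G$ is torsion-free, these are exactly the homogeneous prime ideals). The points of $\mathrm{Proj}_G(R/I)$ are the graded primes $P$ of $R$ with $I\subseteq P$ and $B\not\subseteq P$. Suppose that $\mathrm{Proj}_G(R/I)$ is locally a complete intersection, that is: for every point $P$ of $\mathrm{Proj}_G(R/I)$ and every prime ideal $q$ of $R$ that is minimal over $P$ (so $q=P$ if $P$ is prime), the ideal $IR_q$ of the local ring $R_q$ is generated by an $R_q$-regular sequence. Let $\mathcal R_I=\bigoplus_{t\ge 0}I^tT^t\subseteq R[T]$ be the Rees algebra of $I$, and let $$H^0_B(\mathrm{Sym}_R(I))=\{s\in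 \mathrm{Sym}_R(I) : B^m s=0 \text{ for some } m\ge 0\}.$$ Then $$\mathcal R_I=\mathrm{Sym}_R(I)/H^0_B(\mathrm{Sym}_R(I)),$$ in the sense that the canonical homomorphism of $R$-algebras $\mathrm{Sym}_R(I)\to\mathcal R_I$, which sends $x\in I$ (in degree one) to $xT$, induces an isomorphism $\mathrm{Sym}_R(I)/H^0_B(\mathrm{Sym}_R(I))\cong\mathcal R_I$. -/

import Mathlib

open MvPolynomial

namespace CoxRing

variable {k σ G : Type*} [Field k] [AddCommGroup G]

/-- An ideal of `k[x_i | i ∈ σ]` is monomial if it is generated by monomials. -/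
def IsMonomialIdeal (B : Ideal (MvPolynomial σ k)) : Prop :=
  ∃ s : Set (σ →₀ ℕ), B = Ideal.span ((fun e => monomial e (1 : k)) '' s)

/-- `P` is a graded prime ideal of `k[x_i | i ∈ σ]`, for the `G`-grading in which `x_i` has degree
`deg i` and the constants have degree `0`: a proper homogeneous ideal such that, for homogeneous
`a`, `b`, if `a * b ∈ P` then `a ∈ P` or `b ∈ P`. If `G` is torsion-free these are the homogeneous
prime ideals. -/
structure IsGradedPrime (deg : σ → G) (P : Ideal (MvPolynomial σ k)) : Prop where
  ne_top : P ≠ ⊤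
  homogeneous : ∀ a ∈ P, ∀ g : G, weightedHomogeneousComponent deg g a ∈ P
  mem_or_mem : ∀ (a b : MvPolynomial σ k) (g h : G),
    IsWeightedHomogeneous deg a g → IsWeightedHomogeneous deg b h → a * b ∈ P → a ∈ P ∨ b ∈ P

/-- The points of `Proj_G (R/I)`, where `R = k[x_i | i ∈ σ]` is the Cox ring of `X`, with irrelevant
ideal `B`: the graded primes of `R` that contain `I` but not `B`. -/
def projPoints (deg : σ → G) (B I : Ideal (MvPolynomial σ k)) : Set (Ideal (MvPolynomial σ k)) :=
  {P | IsGradedPrime deg P ∧ I ≤ P ∧ ¬ B ≤ P}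

/-- `I` is a complete intersection locally at the prime `q`: the ideal `I R_q` of the local ring
`R_q` is generated by a regular sequence. -/
def IsCompleteIntersectionAt {R : Type*} [CommRing R] (I q : Ideal R) [q.IsPrime] : Prop :=
  ∃ rs : List (Localization.AtPrime q),
    RingTheory.Sequence.IsRegular (Localization.AtPrime q) rs ∧
      Ideal.ofList rs = I.map (algebraMap R (Localization.AtPrime q))

/-- `Proj_G (R/I)` is locally a complete intersection in `X`: at each of its points `P`, the ideal
`I` is a complete intersection locally at the prime `P` (if `P` is a prime ideal, then it is the only
minimal prime over itself; if `G` has torsion, a graded prime `P` need not be prime, and the primes of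
`R` lying over the point `P` are the minimal primes over `P`). -/
def ProjLocallyCompleteIntersection (deg : σ → G) (B I : Ideal (MvPolynomial σ k)) : Prop :=
  ∀ P ∈ projPoints deg B I, ∀ (q : Ideal (MvPolynomial σ k)) [q.IsPrime],
    q ∈ P.minimalPrimes → IsCompleteIntersectionAt I q

/-- For an ideal `B` of `R` and an `R`-algebra `S`, the ideal `H^0_B(S)` of `S` (local cohomology in
degree `0`): the elements of `S` that are killed by some power of `B`. -/
def localCohomologyZero {R : Type*} [CommRing R] (B : Ideal R) (S : Type*) [CommRing S]
    [Algebra R S] : Ideal S where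
  carrier := {s | ∃ n : ℕ, ∀ b ∈ B ^ n, b • s = 0}
  zero_mem' := ⟨0, fun b _ => smul_zero b⟩
  add_mem' := by
    rintro s t ⟨m, hm⟩ ⟨n, hn⟩
    refine ⟨m + n, fun b hb => ?_⟩
    rw [smul_add, hm b (Ideal.pow_le_pow_right (Nat.le_add_right m n) hb),
      hn b (Ideal.pow_le_pow_right (Nat.le_add_left n m) hb), add_zero]
  smul_mem' := by
    rintro c s ⟨n, hn⟩
    exact ⟨n, fun b hb => by rw [smul_comm, hn b hb, smul_zero]⟩

/-- The canonical `R`-algebra homomorphism `Sym_R(I) → R_I = ⨁ I^t T^t ⊆ R[T]`; it sends `x ∈ I` in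
degree one to `x T`. -/
noncomputable def symToRees {R : Type*} [CommRing R] (I : Ideal R) :
    SymmetricAlgebra R I →ₐ[R] reesAlgebra I :=
  SymmetricAlgebra.lift
    { toFun := fun x => ⟨Polynomial.monomial 1 (x : R),
        reesAlgebra.monomial_mem.mpr (by simp)⟩
      map_add' := fun x y => Subtype.ext (by simp)
      map_smul' := fun c x => Subtype.ext (by simp [Polynomial.smul_monomial]) }

end CoxRing

/-! Let `K` be the kernel of `Sym_R(I) → R[T]`; its image is the Rees algebra, so the claim is `K =
H^0_B`. Since `R[T]` is torsion-free over the domain `R` and `B ≠ 0`, whatever a power of `B` kills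
lies in `K`. For the converse let `J` be the annihilator of `K` in `R`. It suffices that `B ⊆ √J`,
because `B` is finitely generated.

Otherwise some prime `q ⊇ J` omits a monomial of `B`. The ideal `J` is homogeneous
(`weightedHomogeneousComponent_mem_kerAnnihilator`), so it lies in the homogeneous core `P` of `q`,
a graded prime not containing `B`. If `I ⊆ P`, then `P` is a point of Proj, and `I` is locally
generated by a regular sequence at a minimal prime over `P`; if not, `I` is the unit ideal at `q`.
In both cases `I` is of linear type at a prime containing `J`
(`symToPoly_injective_of_isWeaklyRegular`), so `K` vanishes there. As `K` is finitely generated, `J`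
is not inside that prime (`not_kerAnnihilator_le`), a contradiction. -/

namespace CoxRing

/-! ### Forms vanishing on a regular sequence are generated by Koszul relations. -/

section LinearType

variable {A ι : Type*} [CommRing A]

theorem sup_pow_succ_le {S : Type*} [CommRing S] [Algebra A S] (V W : Submodule A S) (t : ℕ) :
    (V ⊔ W) ^ (t + 1) ≤ V ^ (t + 1) ⊔ W * (V ⊔ W) ^ t := by
  induction t with
  | zero => simp
  | succ t ih =>
    rw [pow_succ' (V ⊔ W) (t + 1), Submodule.sup_mul]
    refine sup_le ?_ le_sup_right
    calc
      V * (V ⊔ W) ^ (t + 1) ≤ V * (V ^ (t + 1) ⊔ W * (V ⊔ W) ^ t) := mul_le_mul' le_rfl ih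
      _ = V ^ (t + 1 + 1) ⊔ W * (V * (V ⊔ W) ^ t) := by
        rw [Submodule.mul_sup, ← pow_succ', mul_left_comm]
      _ ≤ _ := by
        refine sup_le_sup le_rfl (mul_le_mul' le_rfl ?_)
        exact (mul_le_mul' le_sup_left le_rfl).trans (pow_succ' _ _).ge

/-- The span of the variables with index in `s`. -/
noncomputable def varSpan (A : Type*) [CommRing A] (s : Set ι) : Submodule A (MvPolynomial ι A) :=
  Submodule.span A (X '' s)

/-- The ideal generated by the Koszul relations between the `a i`, `i ∈ s`. -/
noncomputable def koszulIdeal (a : ι → A) (s : Set ι) : Ideal (MvPolynomial ι A) :=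
  Ideal.span {p | ∃ i ∈ s, ∃ j ∈ s, p = C (a i) * X j - C (a j) * X i}

theorem koszulIdeal_mono (a : ι → A) {s u : Set ι} (h : s ⊆ u) :
    koszulIdeal a s ≤ koszulIdeal a u :=
  Ideal.span_mono fun _ ⟨i, hi, j, hj, e⟩ => ⟨i, h hi, j, h hj, e⟩

theorem koszulIdeal_le_map (a : ι → A) (s : Set ι) :
    koszulIdeal a s ≤ (Ideal.span (a '' s)).map C := by
  refine Ideal.span_le.mpr ?_
  rintro _ ⟨i, hi, j, hj, rfl⟩
  exact Ideal.sub_mem _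
    (Ideal.mul_mem_right _ _ (Ideal.mem_map_of_mem _ (Ideal.subset_span ⟨i, hi, rfl⟩)))
    (Ideal.mul_mem_right _ _ (Ideal.mem_map_of_mem _ (Ideal.subset_span ⟨j, hj, rfl⟩)))

theorem map_aeval_varSpan_pow (a : ι → A) (s : Set ι) (t : ℕ) :
    (varSpan A s ^ t).map (aeval a).toLinearMap = Ideal.span (a '' s) ^ t := by
  rw [Submodule.map_pow, varSpan, Submodule.map_span, ← Set.image_comp]
  have : ((aeval a : MvPolynomial ι A →ₐ[A] A).toLinearMap : MvPolynomial ι A → A) ∘ X = a := by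
    funext i; simp
  rw [this]

theorem aeval_mem_pow {a : ι → A} {s : Set ι} {t : ℕ} {F : MvPolynomial ι A}
    (hF : F ∈ varSpan A s ^ t) : aeval a F ∈ Ideal.span (a '' s) ^ t := by
  rw [← map_aeval_varSpan_pow]
  exact Submodule.mem_map_of_mem hF

theorem exists_mem_varSpan_pow {a : ι → A} {s : Set ι} {t : ℕ} {y : A}
    (hy : y ∈ Ideal.span (a '' s) ^ t) : ∃ F ∈ varSpan A s ^ t, aeval a F = y := by
  rwa [← map_aeval_varSpan_pow] at hy

/-- Every form in the `X i`, `i ∈ s`, vanishing at `a` is in the ideal of the Koszul relations. -/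
def OnlyKoszul (a : ι → A) (s : Set ι) : Prop :=
  ∀ t, ∀ F ∈ varSpan A s ^ t, aeval a F = 0 → F ∈ koszulIdeal a s

theorem C_mul_X_sub_mem {a : ι → A} {s : Set ι} {v : MvPolynomial ι A} (hv : v ∈ varSpan A s)
    {j : ι} : X j * C (aeval a v) - C (a j) * v ∈ koszulIdeal a (insert j s) := by
  induction hv using Submodule.span_induction with
  | mem x hx =>
    obtain ⟨i, hi, rfl⟩ := hx
    exact Ideal.subset_span ⟨i, Or.inr hi, j, Or.inl rfl, by simp [mul_comm]⟩
  | zero => simp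
  | add x y _ _ hx hy =>
    convert add_mem hx hy using 1
    simp only [map_add]; ring
  | smul r x _ hx =>
    convert Ideal.mul_mem_left _ (C r) hx using 1
    rw [map_smul, smul_eq_mul, smul_eq_C_mul, map_mul]; ring

/-- A form of degree `t + 1` has the same value at `a` as a form of degree `t` with coefficients
in the ideal. -/
theorem exists_lower {a : ι → A} {s : Set ι} {t : ℕ} {H : MvPolynomial ι A}
    (hH : H ∈ varSpan A s ^ (t + 1)) :
    ∃ H' ∈ varSpan A s ^ t, H' ∈ (Ideal.span (a '' s)).map C ∧ aeval a H' = aeval a H ∧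
      ∀ j, X j * H' - C (a j) * H ∈ koszulIdeal a (insert j s) := by
  rw [pow_succ'] at hH
  induction hH using Submodule.mul_induction_on' with
  | mem_mul_mem v hv w hw =>
    -- In a product of a linear form `v` and a form `w`, the factor `v` is replaced by its value at
    -- `a`.
    refine ⟨C (aeval a v) * w, ?_, ?_, by simp [← algebraMap_eq], fun j => ?_⟩
    · rw [← smul_eq_C_mul]; exact Submodule.smul_mem _ _ hw
    · refine Ideal.mul_mem_right _ _ (Ideal.mem_map_of_mem _ ?_)
      simpa using aeval_mem_pow (a := a) (t := 1) (by simpa using hv)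
    · convert Ideal.mul_mem_right w _ (C_mul_X_sub_mem (a := a) (j := j) hv) using 1
      ring
  | add x _ y _ hx hy =>
    obtain ⟨x', h1, h2, h3, h4⟩ := hx
    obtain ⟨y', k1, k2, k3, k4⟩ := hy
    refine ⟨x' + y', add_mem h1 k1, add_mem h2 k2, by rw [map_add, map_add, h3, k3], fun j => ?_⟩
    convert add_mem (h4 j) (k4 j) using 1
    ring

/-- This is what turns a condition on the coefficients of a form into a condition on its value at
`a`. -/
theorem monomial_mem_varSpan_pow {s : Set ι} {t : ℕ} {F : MvPolynomial ι A}
    (hF : F ∈ varSpan A s ^ t) : ∀ m ∈ F.support, monomial m (1 : A) ∈ varSpan A s ^ t := by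
  classical
  have h1 : ∀ F ∈ varSpan A s, ∀ m ∈ F.support, monomial m (1 : A) ∈ varSpan A s := by
    intro F hF
    induction hF using Submodule.span_induction with
    | mem x hx =>
      obtain ⟨i, hi, rfl⟩ := hx
      intro m hm
      rw [Finset.mem_singleton.mp (support_monomial_subset hm)]
      exact Submodule.subset_span ⟨i, hi, rfl⟩
    | zero => simp
    | add x y _ _ hx hy =>
      intro m hm
      exact (Finset.mem_union.mp (support_add hm)).elim (hx m) (hy m)
    | smul r x _ hx => exact fun m hm => hx m (support_smul hm)
  induction t generalizing F with
  | zero =>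
    rw [pow_zero, Submodule.mem_one] at hF
    obtain ⟨y, rfl⟩ := hF
    intro m hm
    rw [Finset.mem_singleton.mp (support_monomial_subset hm), pow_zero]
    exact Submodule.one_le.mp le_rfl
  | succ t ih =>
    rw [pow_succ'] at hF ⊢
    induction hF using Submodule.mul_induction_on' with
    | mem_mul_mem v hv w hw =>
      intro m hm
      obtain ⟨m₁, hm₁, m₂, hm₂, rfl⟩ := Finset.mem_add.mp (support_mul v w hm)
      rw [← mul_one (1 : A), ← monomial_mul]
      exact Submodule.mul_mem_mul (h1 v hv _ hm₁) (ih hw _ hm₂)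
    | add x _ y _ hx hy =>
      intro m hm
      exact (Finset.mem_union.mp (support_add hm)).elim (hx m) (hy m)

/-- A nonzerodivisor modulo `J = (a i : i ∈ s)` stays one modulo `J ^ t`. Write `y = Y(a)` with `Y`
of degree `t`, and `c y = Z'(a)` with `Z'` of degree `t` and coefficients in `J`. Then `c Y - Z'`
vanishes at `a`, so it is Koszul and has coefficients in `J`. Hence so do `c Y` and `Y`, which gives
`y ∈ J * J ^ t`. -/
theorem mem_pow_of_mul_mem_pow {a : ι → A} {s : Set ι} (h : OnlyKoszul a s) {c : A}
    (hc : ∀ y, c * y ∈ Ideal.span (a '' s) → y ∈ Ideal.span (a '' s)) (t : ℕ) :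
    ∀ y, c * y ∈ Ideal.span (a '' s) ^ t → y ∈ Ideal.span (a '' s) ^ t := by
  induction t with
  | zero => simp
  | succ t ih =>
    intro y hy
    obtain ⟨Y, hY, rfl⟩ := exists_mem_varSpan_pow (ih y (Ideal.pow_le_pow_right t.le_succ hy))
    obtain ⟨Z, hZ, hZe⟩ := exists_mem_varSpan_pow hy
    obtain ⟨Z', hZ', hZI, hZe', -⟩ := exists_lower (a := a) hZ
    have h1 : C c * Y - Z' ∈ koszulIdeal a s := by
      refine h t _ (sub_mem ?_ hZ') ?_
      · rw [← smul_eq_C_mul]; exact Submodule.smul_mem _ _ hY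
      · rw [map_sub, hZe', hZe, ← smul_eq_C_mul]; simp
    have h2 : C c * Y ∈ (Ideal.span (a '' s)).map C := by
      simpa using add_mem (koszulIdeal_le_map a s h1) hZI
    have h3 : Y ∈ (Ideal.span (a '' s)).map (C : A →+* MvPolynomial ι A) := by
      rw [mem_map_C_iff] at h2 ⊢
      exact fun m => hc _ (by simpa using h2 m)
    rw [pow_succ']
    rw [mem_map_C_iff] at h3
    rw [← support_sum_monomial_coeff Y, map_sum]
    refine sum_mem fun m hm => ?_
    have h4 := aeval_mem_pow (a := a) (monomial_mem_varSpan_pow hY m hm)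
    have h5 : monomial m (coeff m Y) = coeff m Y • monomial m (1 : A) := by simp [smul_monomial]
    rw [h5, map_smul]
    exact Ideal.mul_mem_mul (h3 m) h4

theorem OnlyKoszul.insert_of_regular {a : ι → A} {s : Set ι} (h : OnlyKoszul a s) {j : ι}
    (hj : ∀ y, a j * y ∈ Ideal.span (a '' s) → y ∈ Ideal.span (a '' s)) :
    OnlyKoszul a (insert j s) := by
  have hV : varSpan A (insert j s) = varSpan A s ⊔ Submodule.span A {X j} := by
    rw [varSpan, Set.image_insert_eq, Submodule.span_insert, sup_comm]; rfl
  intro t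
  induction t with
  | zero =>
    intro F hF h0
    rw [pow_zero, Submodule.mem_one] at hF
    obtain ⟨y, rfl⟩ := hF
    simp at h0
    simp [h0]
  | succ t ih =>
    intro F hF h0
    rw [hV] at hF
    obtain ⟨G, hG, K, hK, rfl⟩ := Submodule.mem_sup.mp (sup_pow_succ_le _ _ _ hF)
    obtain ⟨H, hH, rfl⟩ := Submodule.mem_span_singleton_mul.mp hK
    rw [← hV] at hH
    have hG' := aeval_mem_pow (a := a) hG
    -- Here `F = G + X j * H` with `G` free of `X j`, so `a j * H(a) = -G(a)` lies in the power `t +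
    -- 1` of the ideal of `s`, and `a j` can be cancelled.
    have h1 : aeval a H ∈ Ideal.span (a '' s) ^ (t + 1) := by
      refine mem_pow_of_mul_mem_pow h hj _ _ ?_
      have : a j * aeval a H = - aeval a G := by
        rw [map_add, map_mul, aeval_X] at h0
        linear_combination h0
      rw [this]
      exact neg_mem hG'
    obtain ⟨H', hH', e'⟩ := exists_mem_varSpan_pow h1
    obtain ⟨H'', hH'', -, e'', hk⟩ := exists_lower (a := a) hH'
    have k1 : H - H'' ∈ koszulIdeal a (insert j s) := by
      refine ih _ (sub_mem hH ?_) (by rw [map_sub, e'', e', sub_self])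
      exact pow_le_pow_left' (hV ▸ le_sup_left : varSpan A s ≤ _) t hH''
    have k2 : G + C (a j) * H' ∈ koszulIdeal a s := by
      refine h (t + 1) _ (add_mem hG ?_) ?_
      · rw [← smul_eq_C_mul]; exact Submodule.smul_mem _ _ hH'
      · rw [← h0, ← smul_eq_C_mul, map_add, map_add, map_smul, map_mul, aeval_X, e', smul_eq_mul]
    -- `F = (G + a j * H') + X j * (H - H'') + (X j * H'' - a j * H')`, each summand being Koszul.
    convert add_mem (koszulIdeal_mono a (Set.subset_insert j s) k2)
      (add_mem (Ideal.mul_mem_left _ (X j) k1) (hk j)) using 1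
    ring

end LinearType

/-! ### An ideal generated by a weakly regular sequence is of linear type. -/

section Sym

variable {A : Type*} [CommRing A]

/-- The canonical map `Sym_A(I) → A[T]`. -/
noncomputable def symToPoly (I : Ideal A) : SymmetricAlgebra A I →ₐ[A] Polynomial A :=
  (reesAlgebra I).val.comp (symToRees I)

@[simp]
theorem symToPoly_ι (I : Ideal A) (x : I) :
    symToPoly I (SymmetricAlgebra.ι A I x) = Polynomial.monomial 1 (x : A) := by
  simp [symToPoly, symToRees]

theorem ofList_take {rs : List A} (m : ℕ) :
    Ideal.ofList (rs.take m) = Ideal.span (rs.get '' {i | i.val < m}) := by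
  rw [Ideal.ofList]
  congr 1
  ext x
  simp only [Set.mem_ofPred_eq, Set.mem_image, List.mem_take_iff_getElem]
  constructor
  · rintro ⟨i, hi, rfl⟩
    exact ⟨⟨i, by omega⟩, by simp; omega, rfl⟩
  · rintro ⟨i, hi, rfl⟩
    exact ⟨i, by have := i.2; omega, rfl⟩

theorem onlyKoszul_of_isWeaklyRegular {rs : List A}
    (h : RingTheory.Sequence.IsWeaklyRegular A rs) (m : ℕ) (hm : m ≤ rs.length) :
    OnlyKoszul rs.get {i | i.val < m} := by
  induction m with
  | zero =>
    intro t F hF h0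
    have hV : varSpan A {i : Fin rs.length | i.val < 0} = ⊥ := by simp [varSpan]
    rw [hV] at hF
    cases t with
    | zero =>
      obtain ⟨y, rfl⟩ := Submodule.mem_one.mp hF
      simp at h0
      simp [h0]
    | succ t =>
      rw [pow_succ', Submodule.bot_mul, Submodule.mem_bot] at hF
      simp [hF]
  | succ m ih =>
    have e : {i : Fin rs.length | i.val < m + 1} = insert ⟨m, hm⟩ {i | i.val < m} := by
      ext i; simp [Fin.ext_iff]; omega
    rw [e]
    refine (ih (by omega)).insert_of_regular fun y hy => ?_
    rw [← ofList_take] at hy ⊢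
    have hr := h.regular_mod_prev m hm
    have key : ∀ z : A, z ∈ (Ideal.ofList (rs.take m) • ⊤ : Submodule A A) ↔
        z ∈ Ideal.ofList (rs.take m) := fun z => by simp
    rw [← key] at hy ⊢
    rw [← Submodule.Quotient.mk_eq_zero] at hy ⊢
    exact hr.right_eq_zero_of_smul hy

theorem iSup_range_ι_pow (I : Ideal A) :
    ⨆ t : ℕ, LinearMap.range (SymmetricAlgebra.ι A I) ^ t = ⊤ := by
  set W := LinearMap.range (SymmetricAlgebra.ι A I)
  refine eq_top_iff.mpr fun s _ => ?_
  induction s using SymmetricAlgebra.induction with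
  | algebraMap r =>
    exact Submodule.mem_iSup_of_mem 0 (by rw [pow_zero]; exact Submodule.algebraMap_mem r)
  | ι x => exact Submodule.mem_iSup_of_mem 1 (by rw [pow_one]; exact ⟨x, rfl⟩)
  | add a b ha hb => exact add_mem (ha trivial) (hb trivial)
  | mul a b ha hb =>
    have h : (⨆ t : ℕ, W ^ t) * (⨆ t : ℕ, W ^ t) ≤ ⨆ t : ℕ, W ^ t := by
      simp only [Submodule.iSup_mul, Submodule.mul_iSup, ← pow_add]
      exact iSup_le fun i => iSup_le fun j => le_iSup (fun t => W ^ t) _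
    exact h (Submodule.mul_mem_mul (ha trivial) (hb trivial))

theorem aeval_monomial_one {ι : Type*} (a : ι → A) {s : Set ι} {t : ℕ} {F : MvPolynomial ι A}
    (hF : F ∈ varSpan A s ^ t) :
    aeval (fun i => Polynomial.monomial 1 (a i)) F = Polynomial.monomial t (aeval a F) := by
  have h1 : ∀ F ∈ varSpan A s, aeval (fun i => Polynomial.monomial 1 (a i)) F =
      Polynomial.monomial 1 (aeval a F) := by
    intro F hF
    induction hF using Submodule.span_induction with
    | mem x hx => obtain ⟨i, hi, rfl⟩ := hx; simp
    | zero => simp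
    | add x y _ _ hx hy => simp only [map_add, hx, hy]
    | smul r x _ hx => simp only [map_smul, hx]
  induction t generalizing F with
  | zero =>
    rw [pow_zero] at hF
    obtain ⟨y, rfl⟩ := Submodule.mem_one.mp hF
    rw [AlgHom.commutes, AlgHom.commutes]
    rfl
  | succ t ih =>
    rw [pow_succ'] at hF
    induction hF using Submodule.mul_induction_on' with
    | mem_mul_mem v hv w hw =>
      rw [map_mul, map_mul, h1 v hv, ih hw, Polynomial.monomial_mul_monomial, add_comm]
    | add x _ y _ hx hy => simp only [map_add, hx, hy]

theorem symToPoly_injective_of_isWeaklyRegular {rs : List A}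
    (h : RingTheory.Sequence.IsWeaklyRegular A rs) {I : Ideal A} (hI : Ideal.ofList rs = I) :
    Function.Injective (symToPoly I) := by
  have hspan : Ideal.span (Set.range rs.get) = I := by
    rw [← hI, Ideal.ofList]
    congr 1
    ext x
    exact List.mem_iff_get.symm
  have hmem : ∀ i, rs.get i ∈ I := fun i => hspan ▸ Ideal.subset_span ⟨i, rfl⟩
  set τ : Fin rs.length → SymmetricAlgebra A I :=
    fun i => SymmetricAlgebra.ι A I ⟨rs.get i, hmem i⟩
  have hK := onlyKoszul_of_isWeaklyRegular h _ le_rfl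
  have huniv : {i : Fin rs.length | i.val < rs.length} = Set.univ := by ext; simp
  rw [huniv] at hK
  have hW : LinearMap.range (SymmetricAlgebra.ι A I) =
      (varSpan A (Set.univ : Set (Fin rs.length))).map (aeval τ).toLinearMap := by
    have h1 : (Submodule.span A (Set.range rs.get)).map (LinearMap.id : A →ₗ[A] A) = I := by
      rw [Submodule.map_id]; exact hspan
    have h2 : Submodule.span A (Set.range fun i => (⟨rs.get i, hmem i⟩ : I)) = ⊤ := by
      apply Submodule.map_injective_of_injective I.injective_subtype
      rw [Submodule.map_span, ← Set.range_comp, Submodule.map_top, Submodule.range_subtype]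
      exact hspan
    rw [LinearMap.range_eq_map, ← h2, Submodule.map_span, varSpan, Submodule.map_span,
      Set.image_univ, ← Set.range_comp, ← Set.range_comp]
    congr 2
    funext i
    simp [τ]
  have hρ : ∀ F : MvPolynomial (Fin rs.length) A, symToPoly I (aeval τ F) =
      aeval (fun i => Polynomial.monomial 1 (rs.get i)) F := by
    intro F
    rw [← AlgHom.comp_apply]
    congr 1
    ext i
    simp [τ]
  have hkos : koszulIdeal rs.get Set.univ ≤ RingHom.ker (aeval τ) := by
    refine Ideal.span_le.mpr ?_
    rintro _ ⟨i, -, j, -, rfl⟩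
    simp only [SetLike.mem_coe, RingHom.mem_ker, map_sub, map_mul, aeval_X, τ, aeval_C,
      ← Algebra.smul_def, ← map_smul, sub_eq_zero]
    congr 1
    ext
    simp [mul_comm]
  rw [injective_iff_map_eq_zero]
  intro s hs
  have hsm : s ∈ ⨆ t : ℕ, LinearMap.range (SymmetricAlgebra.ι A I) ^ t := by
    rw [iSup_range_ι_pow]; trivial
  obtain ⟨f, hf, rfl⟩ := (Submodule.mem_iSup_iff_exists_finsupp _ _).mp hsm
  have hF : ∀ t, ∃ F ∈ varSpan A (Set.univ : Set (Fin rs.length)) ^ t, aeval τ F = f t := by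
    intro t
    have := hf t
    rwa [hW, ← Submodule.map_pow] at this
  choose F hF hFf using hF
  refine Finset.sum_eq_zero fun t ht => ?_
  change f t = 0
  rw [← hFf]
  refine hkos (hK t _ (hF t) ?_)
  -- The piece of degree `u` maps to a multiple of `T ^ u`, so the coefficient of `T ^ t` isolates
  -- the form `F t` and shows that it vanishes on the sequence.
  have h0 : symToPoly I (f.sum fun _ x => x) =
      ∑ u ∈ f.support, Polynomial.monomial u (aeval rs.get (F u)) := by
    rw [Finsupp.sum, map_sum]
    refine Finset.sum_congr rfl fun u _ => ?_
    rw [← hFf, hρ, aeval_monomial_one _ (hF u)]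
  have h1 := congrArg (fun p => Polynomial.coeff p t) (h0.symm.trans hs)
  simpa [Polynomial.finsetSum_coeff, Polynomial.coeff_monomial, Finsupp.mem_support_iff.mp ht] using h1

end Sym

/-! ### Localization of the symmetric algebra, and the annihilator of the kernel. -/

section BaseChange

variable {R : Type*} [CommRing R]

/-- The scalars act on `C` through a chosen `α`. This covers changes of base ring, and also the
coaction, where `α` is not the usual structure map of the group algebra. -/
theorem exists_sym_ringHom {M C : Type*} [AddCommGroup M] [Module R M] [CommRing C] (α : R →+* C)
    (β : M →+ C) (h : ∀ (r : R) (x : M), β (r • x) = α r * β x) :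
    ∃ Φ : SymmetricAlgebra R M →+* C, (∀ r, Φ (algebraMap R _ r) = α r) ∧
      ∀ x, Φ (SymmetricAlgebra.ι R M x) = β x := by
  let := α.toAlgebra
  refine ⟨(SymmetricAlgebra.lift (R := R) (A := C)
    { toFun := β, map_add' := β.map_add, map_smul' := fun r x => ?_ }).toRingHom, ?_, ?_⟩
  · rw [h]; rfl
  · intro r
    exact AlgHom.commutes _ r
  · intro x
    exact SymmetricAlgebra.lift_ι_apply _ x

theorem sym_ringHom_ext {M C : Type*} [AddCommGroup M] [Module R M] [CommRing C]
    {Φ Ψ : SymmetricAlgebra R M →+* C} (h1 : ∀ r, Φ (algebraMap R _ r) = Ψ (algebraMap R _ r))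
    (h2 : ∀ x, Φ (SymmetricAlgebra.ι R M x) = Ψ (SymmetricAlgebra.ι R M x)) : Φ = Ψ := by
  refine RingHom.ext fun s => ?_
  induction s using SymmetricAlgebra.induction with
  | algebraMap r => exact h1 r
  | ι x => exact h2 x
  | add a b ha hb => rw [map_add, map_add, ha, hb]
  | mul a b ha hb => rw [map_mul, map_mul, ha, hb]

/-- If the extension of `I` to a localization is of linear type, the kernel of `Sym_R(I) → R[T]`
is torsion. -/
theorem exists_smul_eq_zero_of_injective (I : Ideal R) (N : Submonoid R) (A : Type*) [CommRing A]
    [Algebra R A] [IsLocalization N A]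
    (hA : Function.Injective (symToPoly (I.map (algebraMap R A)))) {s : SymmetricAlgebra R I}
    (hs : symToPoly I s = 0) : ∃ u ∈ N, u • s = 0 := by
  let S := SymmetricAlgebra R I
  -- Only half of the base change isomorphism is needed: a map `Φ` from `Sym_A(IA)` to the
  -- localization `Q` of `Sym_R(I)` whose composite with the natural map `Γ` is the localization
  -- map. Then `Γ s = 0` forces `s` to die in `Q`.
  let Q := Localization (Algebra.algebraMapSubmonoid S N)
  let IA := I.map (algebraMap R A)
  let g : I →ₗ[R] IA := Algebra.idealMap A I
  have hN : ∀ u : N, IsUnit (algebraMap R Q u) := fun u => by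
    rw [IsScalarTower.algebraMap_apply R S Q]
    exact IsLocalization.map_units Q
      (⟨_, Algebra.mem_algebraMapSubmonoid_of_mem u⟩ : Algebra.algebraMapSubmonoid S N)
  let α : A →+* Q := IsLocalization.lift (M := N) hN
  have hα : ∀ r, α (algebraMap R A r) = algebraMap R Q r := fun r => IsLocalization.lift_eq _ r
  have hEnd : ∀ u : N, IsUnit (algebraMap R (Module.End R Q) u) := fun u => by
    have h := (hN u).map (Algebra.lmul R Q)
    rwa [AlgHom.commutes] at h
  let β : IA →ₗ[R] Q := IsLocalizedModule.lift N g
    ((IsScalarTower.toAlgHom R S Q).toLinearMap ∘ₗ SymmetricAlgebra.ι R I) hEnd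
  have hβ : ∀ x, β (g x) = algebraMap S Q (SymmetricAlgebra.ι R I x) := fun x =>
    IsLocalizedModule.lift_apply N g _ hEnd x
  have hαβ : ∀ (a : A) (x : IA), β (a • x) = α a * β x := by
    intro a x
    -- `β` is only `R`-linear by construction; clearing the denominator of `a` makes it semilinear
    -- over `A`.
    obtain ⟨⟨r, u⟩, hru⟩ := IsLocalization.surj N a
    refine (hN u).mul_left_cancel ?_
    have h1 : (u : R) • a • x = r • x := by
      rw [← algebraMap_smul A (u : R), ← algebraMap_smul A r, smul_smul, mul_comm]
      exact congrArg (· • x) hru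
    rw [← Algebra.smul_def, ← map_smul, h1, map_smul, Algebra.smul_def, ← hα, ← hα, ← mul_assoc,
      ← map_mul, mul_comm _ a]
    exact congrArg (fun z => α z * β x) hru.symm
  obtain ⟨Φ, hΦ1, hΦ2⟩ := exists_sym_ringHom α β.toAddMonoidHom hαβ
  obtain ⟨Γ, hΓ1, hΓ2⟩ := exists_sym_ringHom (R := R) (M := I)
    ((algebraMap A (SymmetricAlgebra A IA)).comp (algebraMap R A))
    ((SymmetricAlgebra.ι A IA).toAddMonoidHom.comp g.toAddMonoidHom) (fun r x => by
      change SymmetricAlgebra.ι A IA (g (r • x)) =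
        algebraMap A _ (algebraMap R A r) * SymmetricAlgebra.ι A IA (g x)
      rw [map_smul, ← algebraMap_smul A r, map_smul, Algebra.smul_def])
  have hΦΓ : Φ.comp Γ = algebraMap S Q := by
    refine sym_ringHom_ext (fun r => ?_) fun x => ?_
    · rw [RingHom.comp_apply, hΓ1, RingHom.comp_apply, hΦ1, hα, IsScalarTower.algebraMap_apply R S Q]
    · rw [RingHom.comp_apply, hΓ2]
      exact (hΦ2 _).trans (hβ x)
  have hnat : (symToPoly IA).toRingHom.comp Γ =
      (Polynomial.mapRingHom (algebraMap R A)).comp (symToPoly I).toRingHom := by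
    refine sym_ringHom_ext (fun r => ?_) fun x => ?_
    · rw [RingHom.comp_apply, hΓ1]
      simp
    · rw [RingHom.comp_apply, hΓ2]
      change symToPoly IA (SymmetricAlgebra.ι A IA (g x)) =
        Polynomial.map _ (symToPoly I (SymmetricAlgebra.ι R I x))
      rw [symToPoly_ι, symToPoly_ι, Polynomial.map_monomial]
      rfl
  have h0 : Γ s = 0 := by
    refine hA ?_
    rw [map_zero]
    have := congrArg (fun f : _ →+* _ => f s) hnat
    refine this.trans ?_
    change Polynomial.map _ (symToPoly I s) = 0
    rw [hs, Polynomial.map_zero]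
  have h1 : algebraMap S Q s = 0 := by
    rw [← hΦΓ, RingHom.comp_apply, h0, map_zero]
  obtain ⟨⟨_, u, hu, rfl⟩, hm⟩ :=
    (IsLocalization.map_eq_zero_iff (Algebra.algebraMapSubmonoid S N) Q s).mp h1
  exact ⟨u, hu, by rw [Algebra.smul_def]; exact hm⟩

/-- The annihilator in `R` of the kernel of `Sym_R(I) → R[T]`. -/
noncomputable def kerAnnihilator (I : Ideal R) : Ideal R :=
  Module.annihilator R (RingHom.ker (symToPoly I))

theorem mem_kerAnnihilator {I : Ideal R} {a : R} :
    a ∈ kerAnnihilator I ↔ ∀ s, symToPoly I s = 0 → a • s = 0 := by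
  rw [kerAnnihilator, Module.mem_annihilator]
  constructor
  · intro h s hs
    exact congrArg Subtype.val (h ⟨s, hs⟩)
  · intro h s
    exact Subtype.ext (h s.1 s.2)

theorem isNoetherianRing_sym [IsNoetherianRing R] (I : Ideal R) :
    IsNoetherianRing (SymmetricAlgebra R I) := by
  obtain ⟨n, v, hv⟩ := Submodule.fg_iff_exists_fin_generating_family.mp
    (IsNoetherian.noetherian (⊤ : Submodule R I))
  refine isNoetherianRing_of_surjective _ _
    (aeval (R := R) (fun i => SymmetricAlgebra.ι R I (v i))).toRingHom ?_
  rw [← RingHom.range_eq_top, eq_top_iff]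
  intro s _
  induction s using SymmetricAlgebra.induction with
  | algebraMap r => exact ⟨C r, aeval_C _ r⟩
  | ι x =>
    have hx : x ∈ Submodule.span R (Set.range v) := hv ▸ Submodule.mem_top
    induction hx using Submodule.span_induction with
    | mem x hx => obtain ⟨i, rfl⟩ := hx; exact ⟨X i, aeval_X _ i⟩
    | zero => rw [map_zero]; exact zero_mem _
    | add x y _ _ hx hy => rw [map_add]; exact add_mem (hx trivial) (hy trivial)
    | smul r x _ hx =>
      rw [map_smul, Algebra.smul_def]
      exact mul_mem ⟨C r, aeval_C _ r⟩ (hx trivial)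
  | add a b ha hb => exact add_mem (ha trivial) (hb trivial)
  | mul a b ha hb => exact mul_mem (ha trivial) (hb trivial)

/-- Each of finitely many generators of the kernel is killed by an element outside `q`; the product
of these kills the whole kernel. Weak regularity is enough, which leaves room for the unit ideal. -/
theorem not_kerAnnihilator_le [IsNoetherianRing R] (I q : Ideal R) [q.IsPrime]
    {rs : List (Localization.AtPrime q)}
    (h : RingTheory.Sequence.IsWeaklyRegular (Localization.AtPrime q) rs)
    (hrs : Ideal.ofList rs = I.map (algebraMap R (Localization.AtPrime q))) :
    ¬ kerAnnihilator I ≤ q := by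
  have := isNoetherianRing_sym I
  obtain ⟨S, hS⟩ := IsNoetherian.noetherian (RingHom.ker (symToPoly I))
  have hu : ∀ s : S, ∃ u ∈ q.primeCompl, u • (s : SymmetricAlgebra R I) = 0 := fun s =>
    exists_smul_eq_zero_of_injective I q.primeCompl (Localization.AtPrime q)
      (symToPoly_injective_of_isWeaklyRegular h hrs)
      (show s.1 ∈ RingHom.ker (symToPoly I) from hS ▸ Ideal.subset_span s.2)
  choose u hu hus using hu
  intro hle
  refine (prod_mem fun s _ => hu s : ∏ s : S, u s ∈ q.primeCompl) (hle ?_)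
  rw [mem_kerAnnihilator]
  intro s hs
  have hmem : s ∈ Submodule.span (SymmetricAlgebra R I) (S : Set (SymmetricAlgebra R I)) := by
    rw [hS]; exact hs
  clear hs
  induction hmem using Submodule.span_induction with
  | mem x hx =>
    obtain ⟨c, hc⟩ := Finset.dvd_prod_of_mem u (Finset.mem_univ (⟨x, hx⟩ : S))
    rw [hc, mul_comm, mul_smul, hus ⟨x, hx⟩, smul_zero]
  | zero => rw [smul_zero]
  | add x y _ _ hx hy => rw [smul_add, hx, hy, add_zero]
  | smul r x _ hx => rw [smul_eq_mul, ← mul_smul_comm, hx, mul_zero]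

end BaseChange

/-! ### The `G`-grading of the symmetric algebra, and homogeneity of the annihilator. -/

section Coaction

variable {k σ G : Type*} [Field k] [AddCommGroup G]

/-- The coaction `x_i ↦ x_i ⊗ deg i` of the grading of `k[x_i]`; its coefficient at `g` is the
homogeneous component of degree `g`. -/
noncomputable def coaction (deg : σ → G) :
    MvPolynomial σ k →ₐ[k] AddMonoidAlgebra (MvPolynomial σ k) G :=
  aeval fun i => AddMonoidAlgebra.single (deg i) (X i)

theorem coaction_monomial (deg : σ → G) (m : σ →₀ ℕ) (c : k) :
    coaction deg (monomial m c) =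
      AddMonoidAlgebra.single (Finsupp.weight deg m) (monomial m c) := by
  have hC : ∀ c : k, coaction deg (C c : MvPolynomial σ k) = AddMonoidAlgebra.single 0 (C c) :=
    fun c => aeval_C _ c
  induction m using Finsupp.induction_linear generalizing c with
  | zero => rw [map_zero]; exact hC c
  | add m n hm hn =>
    rw [← mul_one c, ← monomial_mul, map_mul, hm, hn, AddMonoidAlgebra.single_mul_single, map_add]
  | single i n =>
    rw [← C_mul_X_pow_eq_monomial, map_mul, map_pow, hC, coaction, aeval_X,
      AddMonoidAlgebra.single_pow, AddMonoidAlgebra.single_mul_single, zero_add,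
      Finsupp.weight_single]

theorem coaction_of_isWeightedHomogeneous {deg : σ → G} {p : MvPolynomial σ k} {g : G}
    (hp : IsWeightedHomogeneous deg p g) : coaction deg p = AddMonoidAlgebra.single g p := by
  conv_lhs => rw [← support_sum_monomial_coeff p, map_sum]
  conv_rhs => rw [← support_sum_monomial_coeff p]
  change _ = AddMonoidAlgebra.singleAddHom g _
  rw [map_sum]
  refine Finset.sum_congr rfl fun m hm => ?_
  rw [coaction_monomial, hp (mem_support_iff.mp hm)]
  rfl

theorem coeff_coaction (deg : σ → G) (p : MvPolynomial σ k) (g : G) :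
    (coaction deg p).coeff g = weightedHomogeneousComponent deg g p := by
  classical
  induction p using MvPolynomial.induction_on' with
  | monomial m c =>
    rw [coaction_monomial, AddMonoidAlgebra.coeff_single, Finsupp.single_apply]
    split_ifs with h
    · exact (IsWeightedHomogeneous.weightedHomogeneousComponent_same
        (isWeightedHomogeneous_monomial _ _ _ h)).symm
    · exact ((isWeightedHomogeneous_monomial _ _ _ rfl).weightedHomogeneousComponent_ne
        g (Ne.symm h)).symm
  | add p q hp hq => rw [map_add, map_add, AddMonoidAlgebra.coeff_add, Finsupp.add_apply, hp, hq]

theorem weightedHomogeneousComponent_mul {deg : σ → G} {a : MvPolynomial σ k} {h : G}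
    (ha : IsWeightedHomogeneous deg a h) (p : MvPolynomial σ k) (g : G) :
    weightedHomogeneousComponent deg g (a * p) =
      a * weightedHomogeneousComponent deg (-h + g) p := by
  rw [← coeff_coaction, map_mul, coaction_of_isWeightedHomogeneous ha,
    AddMonoidAlgebra.coeff_single_mul_apply, coeff_coaction]

theorem weightedHomogeneousComponent_mem_span {deg : σ → G} {F : Set (MvPolynomial σ k)}
    (hF : ∀ f ∈ F, ∃ d, IsWeightedHomogeneous deg f d) {x : MvPolynomial σ k}
    (hx : x ∈ Ideal.span F) (g : G) : weightedHomogeneousComponent deg g x ∈ Ideal.span F := by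
  classical
  let := weightedGradedAlgebra (R := k) (w := deg)
  exact weightedHomogeneousComponent_mem_of_mem k deg
    (Ideal.homogeneous_span _ F fun f hf => hF f hf) hx g

/-- The extension of the coaction to the symmetric algebra of a homogeneous ideal. -/
theorem exists_sym_coaction (deg : σ → G) (I : Ideal (MvPolynomial σ k))
    (hI : ∀ x ∈ I, ∀ g, weightedHomogeneousComponent deg g x ∈ I) :
    ∃ ψ : SymmetricAlgebra (MvPolynomial σ k) I →+*
        AddMonoidAlgebra (SymmetricAlgebra (MvPolynomial σ k) I) G,
      (∀ a, ψ (algebraMap _ _ a) =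
        AddMonoidAlgebra.mapRingHom G (algebraMap (MvPolynomial σ k) _) (coaction deg a)) ∧
      ∀ (x : I) (g : G), (ψ (SymmetricAlgebra.ι _ I x)).coeff g =
        SymmetricAlgebra.ι _ I ⟨weightedHomogeneousComponent deg g x, hI x x.2 g⟩ := by
  let S := SymmetricAlgebra (MvPolynomial σ k) I
  let b : I → AddMonoidAlgebra S G := fun x => .ofCoeff <|
    Finsupp.onFinset (coaction deg (x : MvPolynomial σ k)).coeff.support
      (fun g => SymmetricAlgebra.ι _ I ⟨weightedHomogeneousComponent deg g x, hI x x.2 g⟩)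
      (fun g hg => by
        rw [Finsupp.mem_support_iff, coeff_coaction]
        intro h0
        refine hg ?_
        simp only [h0]
        exact map_zero (SymmetricAlgebra.ι _ I))
  have hb : ∀ x g, (b x).coeff g =
      SymmetricAlgebra.ι _ I ⟨weightedHomogeneousComponent deg g x, hI x x.2 g⟩ := fun x g => rfl
  let β : I →+ AddMonoidAlgebra S G :=
    AddMonoidHom.mk' b fun x y => by
      ext g
      rw [AddMonoidAlgebra.coeff_add, Finsupp.add_apply, hb, hb, hb, ← map_add]
      congr 1
      ext1
      simp
  obtain ⟨ψ, h1, h2⟩ := exists_sym_ringHom (R := MvPolynomial σ k) (M := I)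
    (C := AddMonoidAlgebra S G)
    ((AddMonoidAlgebra.mapRingHom G (algebraMap (MvPolynomial σ k) S)).comp
      (coaction deg).toRingHom) β (fun a x => by
      induction a using MvPolynomial.induction_on' with
      | monomial m c =>
        ext g
        change (b _).coeff g = (AddMonoidAlgebra.mapRingHom G _ (coaction deg _) * b x).coeff g
        rw [coaction_monomial, AddMonoidAlgebra.mapRingHom_single,
          AddMonoidAlgebra.coeff_single_mul_apply, hb, hb, ← Algebra.smul_def, ← map_smul]
        congr 1
        ext1
        exact weightedHomogeneousComponent_mul (isWeightedHomogeneous_monomial _ _ _ rfl) _ _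
      | add p q hp hq => rw [add_smul, map_add, map_add, add_mul, hp, hq])
  refine ⟨ψ, h1, fun x g => ?_⟩
  rw [h2]
  exact hb x g

theorem weightedHomogeneousComponent_mem_kerAnnihilator {deg : σ → G}
    {F : Set (MvPolynomial σ k)} (hF : ∀ f ∈ F, ∃ d, IsWeightedHomogeneous deg f d)
    {I : Ideal (MvPolynomial σ k)} (hIF : I = Ideal.span F) {a : MvPolynomial σ k}
    (ha : a ∈ kerAnnihilator I) (h : G) :
    weightedHomogeneousComponent deg h a ∈ kerAnnihilator I := by
  classical
  have hI : ∀ x ∈ I, ∀ g, weightedHomogeneousComponent deg g x ∈ I := fun x hx g => by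
    subst hIF; exact weightedHomogeneousComponent_mem_span hF hx g
  obtain ⟨ψ, h1, h2⟩ := exists_sym_coaction deg I hI
  set S := SymmetricAlgebra (MvPolynomial σ k) I
  have hψ_ker : ∀ s, symToPoly I s = 0 → ∀ g, symToPoly I ((ψ s).coeff g) = 0 := by
    -- The map to `R[T]` respects the gradings once `T` is given degree `0`, so the kernel contains
    -- the components of its elements.
    have e : (AddMonoidAlgebra.mapRingHom G (symToPoly I).toRingHom).comp ψ =
        (Polynomial.eval₂RingHom (R := MvPolynomial σ k)
          (S := AddMonoidAlgebra (Polynomial (MvPolynomial σ k)) G) ((AddMonoidAlgebra.mapRingHom G Polynomial.C).comp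
          (coaction deg).toRingHom) (AddMonoidAlgebra.single 0 Polynomial.X)).comp
          (symToPoly I).toRingHom := by
      refine sym_ringHom_ext (fun r => ?_) fun x => ?_
      · change AddMonoidAlgebra.mapRingHom G _ (ψ _) =
          Polynomial.eval₂ _ _ (symToPoly I (algebraMap _ _ r))
        rw [h1, AlgHom.commutes, ← Polynomial.C_eq_algebraMap, Polynomial.eval₂_C]
        ext1
        ext1 g
        simp only [AddMonoidAlgebra.coeff_mapRingHom, RingHom.comp_apply]
        exact ((symToPoly I).commutes _).trans rfl
      · change AddMonoidAlgebra.mapRingHom G _ (ψ _) =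
          Polynomial.eval₂ _ _ (symToPoly I (SymmetricAlgebra.ι _ _ x))
        rw [symToPoly_ι, Polynomial.eval₂_monomial, pow_one]
        ext1
        ext1 g
        rw [AddMonoidAlgebra.coeff_mapRingHom, h2, AddMonoidAlgebra.coeff_mul_single_apply,
          RingHom.comp_apply, AddMonoidAlgebra.coeff_mapRingHom]
        change symToPoly I _ = Polynomial.C ((coaction deg (x : MvPolynomial σ k)).coeff _) * _
        rw [symToPoly_ι, coeff_coaction, Polynomial.C_mul_X_eq_monomial]
        simp
    intro s hs g
    have h0 := congrArg (fun f : _ →+* _ => (f s).coeff g) e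
    change (AddMonoidAlgebra.mapRingHom G _ (ψ s)).coeff g =
      AddMonoidAlgebra.coeff (Polynomial.eval₂ _ _ (symToPoly I s)) g at h0
    rwa [hs, Polynomial.eval₂_zero, AddMonoidAlgebra.coeff_mapRingHom] at h0
  -- The homogeneous elements of `S`. They generate `S` additively because `I` has homogeneous
  -- generators.
  let H : Submonoid S :=
    { carrier := {t | ∃ g, ψ t = AddMonoidAlgebra.single g t}
      one_mem' := ⟨0, by rw [map_one]; rfl⟩
      mul_mem' := by
        rintro s t ⟨g, hg⟩ ⟨g', hg'⟩
        exact ⟨g + g', by rw [map_mul, hg, hg', AddMonoidAlgebra.single_mul_single]⟩ }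
  have hψ_alg : ∀ r : MvPolynomial σ k, algebraMap _ S r ∈ H.subsemiringClosure := by
    intro r
    induction r using MvPolynomial.induction_on' with
    | monomial m c =>
      refine AddSubmonoid.subset_closure (s := (H : Set S)) ⟨Finsupp.weight deg m, ?_⟩
      rw [h1, coaction_monomial, AddMonoidAlgebra.mapRingHom_single]
    | add p q hp hq => rw [map_add]; exact add_mem hp hq
  have hψ_top : ∀ s : S, s ∈ H.subsemiringClosure := by
    intro s
    induction s using SymmetricAlgebra.induction with
    | algebraMap r => exact hψ_alg r
    | ι x =>
      obtain ⟨x, hx⟩ := x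
      have hx' := hx
      rw [hIF] at hx'
      induction hx' using Submodule.span_induction with
      | mem x hxF =>
        obtain ⟨d, hd⟩ := hF x hxF
        refine AddSubmonoid.subset_closure (s := (H : Set S)) ⟨d, ?_⟩
        ext1
        ext1 g
        rw [h2, AddMonoidAlgebra.coeff_single, Finsupp.single_apply]
        split_ifs with hg
        · subst hg
          congr 1
          exact Subtype.ext hd.weightedHomogeneousComponent_same
        · rw [← map_zero (SymmetricAlgebra.ι (MvPolynomial σ k) I)]
          congr 1
          exact Subtype.ext (hd.weightedHomogeneousComponent_ne g (Ne.symm hg))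
      | zero =>
        have h0 : (⟨0, hx⟩ : I) = 0 := rfl
        rw [h0, map_zero]
        exact zero_mem _
      | add x y hx' hy' ihx ihy =>
        have hxI : x ∈ I := by rw [hIF]; exact hx'
        have hyI : y ∈ I := by rw [hIF]; exact hy'
        exact (map_add (SymmetricAlgebra.ι (MvPolynomial σ k) I) ⟨x, hxI⟩ ⟨y, hyI⟩).symm ▸
          add_mem (ihx _) (ihy _)
      | smul r x hx' ihx =>
        have hxI : x ∈ I := by rw [hIF]; exact hx'
        have h0 := map_smul (SymmetricAlgebra.ι (MvPolynomial σ k) I) r ⟨x, hxI⟩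
        rw [Algebra.smul_def] at h0
        exact h0.symm ▸ mul_mem (hψ_alg r) (ihx _)
    | add a b ha hb => exact add_mem ha hb
    | mul a b ha hb => exact mul_mem ha hb
  -- The coefficients of `ψ s` are homogeneous and add up to `s`; by additivity this need only be
  -- checked on homogeneous elements.
  have hψ_idem : ∀ s, (∀ g, ψ ((ψ s).coeff g) = AddMonoidAlgebra.single g ((ψ s).coeff g)) ∧
      ((ψ s).coeff.sum fun _ x => x) = s := by
    intro s
    have hs : s ∈ AddSubmonoid.closure (H : Set S) := hψ_top s
    induction hs using AddSubmonoid.closure_induction with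
    | mem t ht =>
      obtain ⟨g, hg⟩ := ht
      rw [hg]
      refine ⟨fun g' => ?_, by simp⟩
      rw [AddMonoidAlgebra.coeff_single, Finsupp.single_apply]
      split_ifs with h
      · rw [hg, h]
      · simp
    | zero => simp
    | add s t _ _ hs ht =>
      refine ⟨fun g => ?_, ?_⟩
      · rw [map_add, AddMonoidAlgebra.coeff_add, Finsupp.add_apply, map_add, hs.1, ht.1,
          AddMonoidAlgebra.single_add]
      · rw [map_add, AddMonoidAlgebra.coeff_add,
          Finsupp.sum_add_index' (fun _ => rfl) (fun _ _ _ => rfl), hs.2, ht.2]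
  rw [mem_kerAnnihilator] at ha ⊢
  intro s hs
  rw [← (hψ_idem s).2, Finsupp.sum, Finset.smul_sum]
  refine Finset.sum_eq_zero fun g _ => ?_
  -- For a component `s_g` in the kernel, `a • s_g = 0`; its part of degree `h + g` is `a_h • s_g`,
  -- with no ordering of `G` needed.
  have h3 := congrArg ψ (ha _ (hψ_ker s hs g))
  rw [map_zero, Algebra.smul_def, map_mul, (hψ_idem s).1, h1] at h3
  have h4 := congrArg (fun z => AddMonoidAlgebra.coeff z (h + g)) h3
  simpa [coeff_coaction, Algebra.smul_def] using h4

end Coaction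

/-! ### The irrelevant ideal lies in the radical of the annihilator. -/

section Main

variable {k σ G : Type*} [Field k] [AddCommGroup G]

theorem le_radical_kerAnnihilator [Finite σ] (deg : σ → G) {B I : Ideal (MvPolynomial σ k)}
    (hB : IsMonomialIdeal B) {F : Set (MvPolynomial σ k)}
    (hF : ∀ f ∈ F, ∃ d, IsWeightedHomogeneous deg f d) (hI : I = Ideal.span F)
    (hCI : ProjLocallyCompleteIntersection deg B I) : B ≤ (kerAnnihilator I).radical := by
  classical
  let := weightedGradedAlgebra (R := k) (w := deg)
  obtain ⟨s, rfl⟩ := hB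
  refine Ideal.span_le.mpr ?_
  rintro _ ⟨e, he, rfl⟩
  by_contra hrad
  rw [SetLike.mem_coe, Ideal.radical_eq_sInf, Submodule.mem_sInf] at hrad
  push Not at hrad
  obtain ⟨q, ⟨hJq, hq⟩, heq⟩ : ∃ q : Ideal (MvPolynomial σ k),
    (kerAnnihilator I ≤ q ∧ q.IsPrime) ∧ monomial e (1 : k) ∉ q := hrad
  set P := (q.homogeneousCore (weightedHomogeneousSubmodule k deg)).toIdeal with hP
  have hPq : P ≤ q := q.toIdeal_homogeneousCore_le _
  have hmem : ∀ {x d}, IsWeightedHomogeneous deg x d → x ∈ q → x ∈ P := fun hx hxq =>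
    Ideal.mem_homogeneousCore_of_homogeneous_of_mem ⟨_, hx⟩ hxq
  have hJP : kerAnnihilator I ≤ P := by
    intro a ha
    rw [hP, mem_iff_weightedHomogeneousComponent_mem k deg
      (q.homogeneousCore _).isHomogeneous]
    exact fun g => hmem (weightedHomogeneousComponent_isWeightedHomogeneous _ _)
      (hJq (weightedHomogeneousComponent_mem_kerAnnihilator hF hI ha g))
  by_cases hIP : I ≤ P
  · have hPt : P ∈ projPoints deg (Ideal.span ((fun e => monomial e (1 : k)) '' s)) I := by
      refine ⟨⟨fun h => hq.ne_top (top_le_iff.mp (h ▸ hPq)), fun a ha g =>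
        weightedHomogeneousComponent_mem_of_mem k deg (q.homogeneousCore _).isHomogeneous ha g,
        fun a b g h ha hb hab => ?_⟩, hIP, fun h => heq (hPq (h (Ideal.subset_span ⟨e, he, rfl⟩)))⟩
      exact (hq.mem_or_mem (hPq hab)).imp (hmem ha) (hmem hb)
    -- `P` need not be prime when `G` has torsion, so the hypothesis is applied at a minimal prime
    -- over it, which still contains the annihilator.
    obtain ⟨q', hq', -⟩ := Ideal.exists_minimalPrimes_le hPq
    have := hq'.1.1
    obtain ⟨rs, hrs, hrI⟩ := hCI P hPt q' hq'
    exact not_kerAnnihilator_le I q' hrs.toIsWeaklyRegular hrI (hJP.trans hq'.1.2)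
  · have hIq : ¬ I ≤ q := by
      intro h
      refine hIP ?_
      rw [hI] at h ⊢
      refine Ideal.span_le.mpr fun f hf => ?_
      obtain ⟨d, hd⟩ := hF f hf
      exact hmem hd (h (Ideal.subset_span hf))
    -- Off the zero locus of `I` the local ideal is the unit ideal; the sequence `[1]` is weakly
    -- regular though not regular.
    refine not_kerAnnihilator_le I q (rs := [1]) ?_ ?_ hJq
    · rw [RingTheory.Sequence.isWeaklyRegular_singleton_iff]
      exact fun x y h => by simpa using h
    · rw [Ideal.ofList_singleton, Ideal.span_singleton_one]
      obtain ⟨x, hx, hxq⟩ := SetLike.not_le_iff_exists.mp hIq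
      exact (Ideal.eq_top_of_isUnit_mem _ (Ideal.mem_map_of_mem _ hx)
        (IsLocalization.map_units (M := q.primeCompl) _ ⟨x, hxq⟩)).symm

theorem symToRees_surjective {R : Type*} [CommRing R] (I : Ideal R) :
    Function.Surjective (symToRees I) := by
  rintro ⟨p, hp⟩
  have h : reesAlgebra I ≤ (symToPoly I).range := by
    rw [← adjoin_monomial_eq_reesAlgebra]
    refine Algebra.adjoin_le ?_
    rintro _ ⟨x, hx, rfl⟩
    exact ⟨SymmetricAlgebra.ι R I ⟨x, hx⟩, symToPoly_ι I _⟩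
  obtain ⟨s, hs⟩ := h hp
  exact ⟨s, Subtype.ext hs⟩

theorem localCohomologyZero_le_ker_symToRees {R : Type*} [CommRing R] [IsDomain R]
    {B : Ideal R} (hB : B ≠ ⊥) (I : Ideal R) :
    localCohomologyZero B (SymmetricAlgebra R I) ≤ RingHom.ker (symToRees I) := by
  rintro s ⟨n, hn⟩
  obtain ⟨b, hb, hb0⟩ := Submodule.exists_mem_ne_zero_of_ne_bot hB
  have h := congrArg (symToPoly I) (hn _ (Ideal.pow_mem_pow hb n))
  rw [map_smul, map_zero] at h
  exact Subtype.ext ((smul_eq_zero.mp h).resolve_left (pow_ne_zero n hb0))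

end Main
end CoxRing

theorem proposition2p2 {k σ G : Type*} [Field k] [Finite σ] [AddCommGroup G] (deg : σ → G)
    (B : Ideal (MvPolynomial σ k)) (hB : CoxRing.IsMonomialIdeal B) (hB0 : B ≠ ⊥)
    (r : ℕ) (d : G) (f : Fin r → MvPolynomial σ k)
    (hf : ∀ i, MvPolynomial.IsWeightedHomogeneous deg (f i) d)
    (I : Ideal (MvPolynomial σ k)) (hI : I = Ideal.span (Set.range f))
    (hCI : CoxRing.ProjLocallyCompleteIntersection deg B I) :
    ∃ e : (SymmetricAlgebra (MvPolynomial σ k) I ⧸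
          CoxRing.localCohomologyZero B (SymmetricAlgebra (MvPolynomial σ k) I))
        ≃ₐ[MvPolynomial σ k] reesAlgebra I,
      ∀ s : SymmetricAlgebra (MvPolynomial σ k) I,
        e (Ideal.Quotient.mk _ s) = CoxRing.symToRees I s := by
  have hrad := CoxRing.le_radical_kerAnnihilator deg hB (F := Set.range f)
    (by rintro _ ⟨i, rfl⟩; exact ⟨d, hf i⟩) hI hCI
  obtain ⟨n, hn⟩ := Ideal.exists_pow_le_of_le_radical_of_fg hrad (IsNoetherian.noetherian B)
  have hker : RingHom.ker (CoxRing.symToRees I) =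
      CoxRing.localCohomologyZero B (SymmetricAlgebra (MvPolynomial σ k) I) := by
    refine le_antisymm (fun s hs => ⟨n, fun b hb => ?_⟩)
      (CoxRing.localCohomologyZero_le_ker_symToRees hB0 I)
    exact CoxRing.mem_kerAnnihilator.mp (hn hb) s (congrArg Subtype.val hs)
  exact ⟨(Ideal.quotientEquivAlgOfEq _ hker.symm).trans
    (Ideal.quotientKerAlgEquivOfSurjective (CoxRing.symToRees_surjective I)), fun s => rfl⟩
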